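/- Throughout, a hypergraph $\mathcal H=(\mathcal V(\mathcal H),\mathcal E(\mathcal H))$ consists of a finite vertex set and a set of non-empty subsets of it (the edges), no edge being properly contained in another. For a vertex $x$, the deletion $\mathcal H\setminus x$ has vertex set $\mathcal V(\mathcal H)\setminus\{x\}$ and edges $\{E\in\mathcal E(\mathcal H): x\notin E\}$; if $\{x\}\notin\mathcal E(\mathcal H)$, the contraction $\mathcal H/x$ has vertex set $\mathcal V(\mathcal H)\setminus\{x\}$ and edges $\{F\setminus\{x\}: x\in F\in\mathcal E(\mathcal H)\}\cup\{E\in\mathcal E(\mathcal H): x\notin E,\ F\setminus\{x\}\not\subseteq E \text{ for all } F\in\mathcal E(\mathcal H)\setminus\{E\}\}$. A set $W\subseteq\mathcal V(\mathcal H)$ is independent if it contains no edge. The hypergraph $\mathcal H$ is vertex decomposable, defined recursively, if either every vertex $x$ satisfies $\{x\}\in\mathcal E(\mathcal H)$ or lies in no edge, or there is a vertex $x$ with $\{x\}\notin\mathcal E(\mathcal H)$ such that $\mathcal H/x$ and $\mathcal H\setminus x$ are vertex decomposable and every independent set of $\mathcal H/x$ is properly contained in an independent set of $\mathcal H\setminus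 x$. Let $\Delta$ be a simplicial complex on a finite vertex set. A facet $F$ of $\Delta$ is a leaf if it is the only facet, or there is a facet $G\neq F$ with $F\cap H\subseteq F\cap G$ for every facet $H\ne F$. A subcollection of $\Delta$ is a simplicial complex all of whose facets are facets of $\Delta$. The complex $\Delta$ is a simplicial tree if any two facets are joined by a sequence of facets in which consecutive ones intersect, and every non-empty subcollection of $\Delta$ has a leaf. Let $\mathcal H(\Delta)$ be the hypergraph whose edges are the facets of $\Delta$. For a hypergraph $\mathcal H$ with edges $F_1,\dots,F_t$ and $\mathbf k_t=(k_1,\dots,k_t)\in\mathbb N_{>0}^t$, let $\mathcal H(\mathbf k_t)$ be the hypergraph with vertices $x_{j,f}$ for all $i$, all $x_j\in F_i$ and all $1\le f\le k_i$, whose edges are, for each $i$ with $F_i=\{x_{j_1},\dots,x_{j_b}\}$ ($b=|F_i|$), all sets $\{x_{j_1,f_1},\dots,x_{j_b,f_b}\}$ with $f_1,\dots,f_b\in\{1,\dots,k_i\}$ and $f_1+\cdots+f_b\le k_i+b-1$. **Theorem 3.4.** Let $\Delta$ be a simplicial tree with facets $F_1,\dots,F_t$, let $\mathbf k_t\in\mathbb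 N^t_{>0}$, and let $\mathcal H=\mathcal H(\Delta)$. Then the hypergraph $\mathcal H(\mathbf k_t)$ is vertex decomposable. -/

import Mathlib

namespace PreAbstractSimplicialComplex

variable {V : Type*}

/-- The facets (inclusion-maximal faces) of a simplicial complex. -/
def facets (Δ : PreAbstractSimplicialComplex V) : Set (Finset V) :=
  {F | Maximal (fun G => G ∈ Δ.faces) F}

/-- `Γ` is a subcollection of `Δ`: every facet of `Γ` is a facet of `Δ`. -/
def IsSubcollection (Γ Δ : PreAbstractSimplicialComplex V) : Prop :=
  Γ.facets ⊆ Δ.facets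

/-- `Δ` is connected: any two facets are joined by a chain of facets in which consecutive
members intersect. -/
def IsConnected (Δ : PreAbstractSimplicialComplex V) : Prop :=
  ∀ F ∈ Δ.facets, ∀ G ∈ Δ.facets,
    Relation.ReflTransGen
      (fun A B : Finset V =>
        A ∈ Δ.facets ∧ B ∈ Δ.facets ∧ ((A : Set V) ∩ (B : Set V)).Nonempty) F G

/-- The facet `F` is a leaf of `Δ`: it is the only facet, or there is another facet `G` (a branch)
such that `F ∩ H ⊆ F ∩ G` for every facet `H ≠ F`. -/
def IsLeaf (Δ : PreAbstractSimplicialComplex V) (F : Finset V) : Prop :=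
  F ∈ Δ.facets ∧
    (Δ.facets = {F} ∨
      ∃ G ∈ Δ.facets, G ≠ F ∧
        ∀ H ∈ Δ.facets, H ≠ F → (F : Set V) ∩ (H : Set V) ⊆ (F : Set V) ∩ (G : Set V))

/-- `Δ` is a simplicial tree: it is connected and every non-empty subcollection has a leaf. -/
def IsSimplicialTree (Δ : PreAbstractSimplicialComplex V) : Prop :=
  Δ.IsConnected ∧
    ∀ Γ : PreAbstractSimplicialComplex V,
      Γ.IsSubcollection Δ → Γ.facets.Nonempty → ∃ F, Γ.IsLeaf F

/-- The hypergraph on the vertices of `Δ` whose edges are the facets of `Δ`. -/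
def facetHypergraph (Δ : PreAbstractSimplicialComplex V) : Hypergraph V where
  vertexSet := {v | ({v} : Finset V) ∈ Δ.faces}
  edgeSet := (fun F : Finset V => (F : Set V)) '' Δ.facets
  subset_vertexSet_of_mem_edgeSet' := by
    rintro _ ⟨F, hF, rfl⟩ v hv
    exact (Δ.isRelLowerSet_faces hF.prop).2 (Finset.singleton_subset_iff.2 hv)
      (Finset.singleton_nonempty v)

end PreAbstractSimplicialComplex

namespace Hypergraph

variable {α : Type*}

/-- Every vertex of `H` is isolated, in the sense that it forms an edge by itself or lies in no
edge at all. -/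
def IsIsolatedHypergraph (H : Hypergraph α) : Prop :=
  ∀ x ∈ H.vertexSet, {x} ∈ H.edgeSet ∨ ∀ E ∈ H.edgeSet, x ∉ E

/-- `W` is an independent set of `H`: every edge has a vertex outside `W`. -/
def IsIndependent (H : Hypergraph α) (W : Set α) : Prop :=
  W ⊆ H.vertexSet ∧ ∀ E ∈ H.edgeSet, (E ∩ (H.vertexSet \ W)).Nonempty

/-- The deletion `H \ x`. -/
def deletion (H : Hypergraph α) (x : α) : Hypergraph α where
  vertexSet := H.vertexSet \ {x}
  edgeSet := {E | E ∈ H.edgeSet ∧ x ∉ E}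
  subset_vertexSet_of_mem_edgeSet' := by
    rintro E ⟨hE, hx⟩ v hv
    exact ⟨H.subset_vertexSet_of_mem_edgeSet' hE hv, fun h => hx (h ▸ hv)⟩

/-- The contraction `H / x` of a simple hypergraph: its edges are the inclusion-minimal sets among
the `E \ {x}`, that is, the sets `F \ {x}` for edges `F` through `x`, together with the edges `E`
that avoid `x` and contain no `F \ {x}` with `F ≠ E` an edge. -/
def contraction (H : Hypergraph α) (x : α) : Hypergraph α where
  vertexSet := H.vertexSet \ {x}
  edgeSet :=
    {E | ∃ F ∈ H.edgeSet, x ∈ F ∧ E = F \ {x}} ∪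
      {E | E ∈ H.edgeSet ∧ x ∉ E ∧ ∀ F ∈ H.edgeSet, F ≠ E → ¬ F \ {x} ⊆ E}
  subset_vertexSet_of_mem_edgeSet' := by
    rintro E (⟨F, hF, -, rfl⟩ | ⟨hE, hx, -⟩) v hv
    · exact ⟨H.subset_vertexSet_of_mem_edgeSet' hF hv.1, hv.2⟩
    · exact ⟨H.subset_vertexSet_of_mem_edgeSet' hE hv, fun h => hx (h ▸ hv)⟩

/-- Vertex decomposable (simple) hypergraphs. Edges of a hypergraph are non-empty by convention,
so `H / x` is only formed when `{x}` is not an edge, i.e. when `x` is a vertex of the independence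
complex of `H`. -/
inductive IsVertexDecomposable : Hypergraph α → Prop
  | isolated (H : Hypergraph α) (h : H.IsIsolatedHypergraph) : IsVertexDecomposable H
  | shedding (H : Hypergraph α) (x : α) (hx : x ∈ H.vertexSet) (hxE : {x} ∉ H.edgeSet)
      (hcontraction : IsVertexDecomposable (H.contraction x))
      (hdeletion : IsVertexDecomposable (H.deletion x))
      (hshedding : ∀ W, (H.contraction x).IsIndependent W →
        ∃ W', (H.deletion x).IsIndependent W' ∧ W ⊂ W') :
      IsVertexDecomposable H

/-- The hypergraph `H(k)` for a family `k` of natural numbers indexed by the (finite) edges of `H`.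
The pair `(v, f)` stands for the vertex `x_{v,f}`. An edge `F` contributes the vertices `x_{v,f}`
with `v ∈ F` and `1 ≤ f ≤ k_F` (only `f = 1` if `k_F = 0`), and the edges `{x_{v,f(v)} : v ∈ F}`
for all `f : F → {1, …, k_F}` whose values have sum at most `k_F + |F| - 1`. Only the values of `f`
on `F` matter. -/
noncomputable def expansion (H : Hypergraph α) (k : H.edgeSet → ℕ) : Hypergraph (α × ℕ) where
  vertexSet := {p | ∃ F : H.edgeSet, p.1 ∈ (F : Set α) ∧ 1 ≤ p.2 ∧ p.2 ≤ max 1 (k F)}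
  edgeSet :=
    {E | ∃ (F : H.edgeSet) (f : α → ℕ),
      (∀ v ∈ (F : Set α), 1 ≤ f v ∧ f v ≤ k F) ∧
      ∑ᶠ v ∈ (F : Set α), f v ≤ k F + (F : Set α).ncard - 1 ∧
      E = (fun v => (v, f v)) '' (F : Set α)}
  subset_vertexSet_of_mem_edgeSet' := by
    rintro _ ⟨F, f, hf, -, rfl⟩ _ ⟨v, hv, rfl⟩
    exact ⟨F, hv, (hf v hv).1, (hf v hv).2.trans (le_max_right _ _)⟩

end Hypergraph

/-! For simple hypergraphs, contraction and deletion of `x` correspond to link and deletion of `x`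
in the independence complex, so it suffices to decompose that complex. After subtracting 1 from
every exponent, a set is independent in the expansion exactly when every choice of one vertex
`x_{v,f v}` in it per `v ∈ F i` has total weight at least `k i`. Allowing variable offsets `o` and
ceilings `N` gives the class `weightComplex`, which is closed under the two operations at `(y, o
y)`: deletion lowers `k i` on the constraints through `y`, the link erases `y` from all constraints,
and both raise `o y` by one. The decomposition is thus an induction on `∑ (N v - o v)`. The shedding
condition needs `y` in some `F i₀` such that every active constraint (`0 < k i`) meeting `F i₀`
contains `y`. This is where the tree enters: the intersection graph of a family with leaves is
chordal, so, as in Dirac's theorem, some member has pairwise meeting neighbours, and the Helly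
property puts a common vertex `y` in all of them (`HasLeaves.exists_dominating`). The leaf property
survives passing to subfamilies and erasing vertices, so the induction continues. -/

/-! ### From hypergraphs to independence complexes -/

/-- Vertex decomposability of a simplicial complex, given as its collection of faces (including
the empty one). -/
inductive IsVertexDecomposableComplex {β : Type*} : Set (Set β) → Prop
  | simplex (S : Set β) : IsVertexDecomposableComplex (𝒫 S)
  | shedding (I : Set (Set β)) (x : β) (hx : {x} ∈ I)
      (hlink : IsVertexDecomposableComplex {W | x ∉ W ∧ insert x W ∈ I})
      (hdeletion : IsVertexDecomposableComplex {W | x ∉ W ∧ W ∈ I})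
      (hshedding : ∀ W, x ∉ W → insert x W ∈ I → ∃ W' ∈ I, x ∉ W' ∧ W ⊂ W') :
      IsVertexDecomposableComplex I

namespace Hypergraph

variable {α : Type*}

/-- A hypergraph is simple if its edges are non-empty and pairwise incomparable. -/
def IsSimple (H : Hypergraph α) : Prop :=
  ∅ ∉ H.edgeSet ∧ ∀ E ∈ H.edgeSet, ∀ F ∈ H.edgeSet, E ⊆ F → E = F

theorem isIndependent_iff (H : Hypergraph α) (W : Set α) :
    H.IsIndependent W ↔ W ⊆ H.vertexSet ∧ ∀ E ∈ H.edgeSet, ¬ E ⊆ W := by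
  refine and_congr_right fun _ => forall₂_congr fun E hE => ?_
  rw [Set.not_subset]
  constructor
  · rintro ⟨v, hv, -, hvW⟩
    exact ⟨v, hv, hvW⟩
  · rintro ⟨v, hv, hvW⟩
    exact ⟨v, hv, H.subset_vertexSet_of_mem_edgeSet' hE hv, hvW⟩

theorem IsSimple.deletion {H : Hypergraph α} (hH : H.IsSimple) (x : α) :
    (H.deletion x).IsSimple :=
  ⟨fun h => hH.1 h.1, fun E hE F hF => hH.2 E hE.1 F hF.1⟩

theorem IsSimple.contraction {H : Hypergraph α} (hH : H.IsSimple) {x : α}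
    (hx : {x} ∉ H.edgeSet) : (H.contraction x).IsSimple := by
  constructor
  · rintro (⟨F, hF, hxF, h⟩ | h)
    · have : F = {x} := Set.Subset.antisymm (Set.sdiff_eq_empty.1 h.symm)
        (Set.singleton_subset_iff.2 hxF)
      exact hx (this ▸ hF)
    · exact hH.1 h.1
  · rintro E (⟨F, hF, hxF, rfl⟩ | ⟨hE, hxE, hmin⟩) E' (⟨F', hF', hxF', rfl⟩ | ⟨hE', hxE', hmin'⟩) h
    · rw [hH.2 F hF F' hF' fun v hv => ?_]
      by_cases hvx : v = x
      · exact hvx ▸ hxF'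
      · exact (h ⟨hv, hvx⟩).1
    · exact absurd h (hmin' F hF fun hFE => hxE' (hFE ▸ hxF))
    · have := hH.2 E hE F' hF' (h.trans Set.sdiff_subset)
      exact absurd (this ▸ hxF') hxE
    · exact hH.2 E hE E' hE' h

theorem isIndependent_deletion_iff (H : Hypergraph α) (x : α) (W : Set α) :
    (H.deletion x).IsIndependent W ↔ x ∉ W ∧ H.IsIndependent W := by
  simp only [isIndependent_iff]
  constructor
  · rintro ⟨hW, hE⟩
    have hxW : x ∉ W := fun h => (hW h).2 rfl
    exact ⟨hxW, fun v hv => (hW hv).1, fun E hEH hEW => hE E ⟨hEH, fun h => hxW (hEW h)⟩ hEW⟩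
  · rintro ⟨hxW, hW, hE⟩
    exact ⟨fun v hv => ⟨hW hv, fun h => hxW (h ▸ hv)⟩, fun E hEH => hE E hEH.1⟩

/-- An edge discarded by the contraction contains some `F \ {x}`; simplicity forces `x ∈ F`, so `F \
{x}` is itself an edge of the contraction and discarding loses no constraint. -/
theorem IsSimple.isIndependent_contraction_iff {H : Hypergraph α} (hH : H.IsSimple) {x : α}
    (hx : x ∈ H.vertexSet) (W : Set α) :
    (H.contraction x).IsIndependent W ↔ x ∉ W ∧ H.IsIndependent (insert x W) := by
  simp only [isIndependent_iff]
  constructor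
  · rintro ⟨hW, hE⟩
    have hxW : x ∉ W := fun h => (hW h).2 rfl
    have key : ∀ E ∈ H.edgeSet, x ∈ E → ¬ E \ {x} ⊆ W := fun E hEH hxE =>
      hE _ (Or.inl ⟨E, hEH, hxE, rfl⟩)
    refine ⟨hxW, Set.insert_subset hx fun v hv => (hW hv).1, fun E hEH hEW => ?_⟩
    by_cases hxE : x ∈ E
    · exact key E hEH hxE (Set.sdiff_singleton_subset_iff.2 hEW)
    · have hEW' : E ⊆ W := (Set.subset_insert_iff_of_notMem hxE).1 hEW
      refine hE E (Or.inr ⟨hEH, hxE, fun F hF hFE hFE' => ?_⟩) hEW'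
      by_cases hxF : x ∈ F
      · exact key F hF hxF (hFE'.trans hEW')
      · rw [Set.sdiff_singleton_eq_self hxF] at hFE'
        exact hFE (hH.2 F hF E hEH hFE')
  · rintro ⟨hxW, hW, hE⟩
    refine ⟨fun v hv => ⟨hW (Or.inr hv), fun h => hxW (h ▸ hv)⟩, ?_⟩
    rintro E (⟨F, hF, hxF, rfl⟩ | ⟨hEH, -⟩) hEW
    · exact hE F hF (Set.sdiff_singleton_subset_iff.1 hEW)
    · exact hE E hEH (hEW.trans (Set.subset_insert _ _))

/-- A simple hypergraph whose independence complex is vertex decomposable is vertex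
decomposable. -/
theorem IsSimple.isVertexDecomposable {I : Set (Set α)} (hI : IsVertexDecomposableComplex I) :
    ∀ {H : Hypergraph α}, H.IsSimple → {W | H.IsIndependent W} = I → H.IsVertexDecomposable := by
  induction hI with
  | simplex S =>
    intro H hH hS
    refine .isolated H fun x hx => or_iff_not_imp_right.2 fun h => ?_
    push Not at h
    obtain ⟨E, hE, hxE⟩ := h
    have key : ∀ W, H.IsIndependent W ↔ W ⊆ S := fun W => by
      rw [← Set.mem_powerset_iff, ← hS, Set.mem_ofPred_eq]
    have hES : ¬ E ⊆ S := fun h =>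
      ((isIndependent_iff _ _).1 ((key E).2 h)).2 E hE subset_rfl
    -- As `{y}` is dependent it contains an edge, which must be `{y}`; incomparability of edges then
    -- gives `E = {y}`.
    obtain ⟨y, hyE, hyS⟩ := Set.not_subset.1 hES
    have hy : ¬ H.IsIndependent {y} := fun h => hyS ((key _).1 h rfl)
    rw [isIndependent_iff] at hy
    push Not at hy
    obtain ⟨F, hF, hFy⟩ := hy
      (Set.singleton_subset_iff.2 (H.subset_vertexSet_of_mem_edgeSet' hE hyE))
    rcases Set.subset_singleton_iff_eq.1 hFy with rfl | rfl
    · exact absurd hF hH.1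
    · obtain rfl := hH.2 _ hF E hE (Set.singleton_subset_iff.2 hyE)
      obtain rfl : x = y := hxE
      exact hF
  | shedding I x hx _ _ hshed ihlink ihdel =>
    rintro H hH rfl
    have hx' := (isIndependent_iff _ _).1 hx
    have hxV : x ∈ H.vertexSet := hx'.1 rfl
    have hxE : {x} ∉ H.edgeSet := fun h => hx'.2 _ h subset_rfl
    refine .shedding H x hxV hxE (ihlink (hH.contraction hxE) ?_) (ihdel (hH.deletion x) ?_) ?_
    · ext W
      exact hH.isIndependent_contraction_iff hxV W
    · ext W
      exact H.isIndependent_deletion_iff x W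
    · intro W hW
      obtain ⟨hxW, hW⟩ := (hH.isIndependent_contraction_iff hxV W).1 hW
      obtain ⟨W', hW', hxW', hWW'⟩ := hshed W hxW hW
      exact ⟨W', (H.isIndependent_deletion_iff x W').2 ⟨hxW', hW'⟩, hWW'⟩

end Hypergraph

/-! ### Families with leaves: the Helly property -/

section LeafFamilies

variable {V : Type*} [DecidableEq V]

/-- Every non-empty subfamily of `𝓢` has a leaf. -/
def HasLeaves (𝓢 : Finset (Finset V)) : Prop :=
  ∀ 𝓣 ⊆ 𝓢, 𝓣.Nonempty → ∃ F ∈ 𝓣, 𝓣 = {F} ∨ ∃ G ∈ 𝓣, G ≠ F ∧ ∀ H ∈ 𝓣, H ≠ F → F ∩ H ⊆ G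

theorem HasLeaves.mono {𝓢 𝓣 : Finset (Finset V)} (h : HasLeaves 𝓢) (hT : 𝓣 ⊆ 𝓢) :
    HasLeaves 𝓣 :=
  fun 𝓤 hU => h 𝓤 (hU.trans hT)

/-- Lifting a subfamily along one chosen preimage per member keeps distinct members distinct, so a
leaf and its branch descend. Used for traces `A ∩ ·` and for erasing a vertex. -/
theorem HasLeaves.image {𝓢 : Finset (Finset V)} (h : HasLeaves 𝓢) (φ : Finset V → Finset V)
    (hφ : ∀ F G H, F ∩ H ⊆ G → φ F ∩ φ H ⊆ φ G) : HasLeaves (𝓢.image φ) := by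
  intro 𝓣 hT hne
  have hlift : ∀ E ∈ 𝓣, ∃ F ∈ 𝓢, φ F = E := fun E hE => Finset.mem_image.1 (hT hE)
  choose! σ hσ hφσ using hlift
  obtain ⟨F, hF, h⟩ := h (𝓣.image σ)
    (fun E hE => by
      obtain ⟨A, hA, rfl⟩ := Finset.mem_image.1 hE
      exact hσ A hA) (hne.image σ)
  obtain ⟨A, hA, rfl⟩ := Finset.mem_image.1 hF
  refine ⟨A, hA, h.imp (fun h => ?_) ?_⟩
  · refine Finset.eq_singleton_iff_unique_mem.2 ⟨hA, fun B hB => ?_⟩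
    have : σ B = σ A := Finset.mem_singleton.1 (h ▸ Finset.mem_image_of_mem σ hB)
    rw [← hφσ A hA, ← hφσ B hB, this]
  · rintro ⟨G, hG, hGA, hleaf⟩
    obtain ⟨B, hB, rfl⟩ := Finset.mem_image.1 hG
    refine ⟨B, hB, fun h => hGA (h ▸ rfl), fun C hC hCA => ?_⟩
    rw [← hφσ A hA, ← hφσ B hB, ← hφσ C hC]
    refine hφ _ _ _ (hleaf _ (Finset.mem_image_of_mem σ hC) fun h => hCA ?_)
    rw [← hφσ A hA, ← hφσ C hC, h]

/-- In three distinct members, a leaf meets the non-branch member inside the branch, so that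
intersection lies in all three. -/
theorem HasLeaves.nonempty_inter_inter {𝓢 : Finset (Finset V)} (h : HasLeaves 𝓢)
    {A B C : Finset V} (hA : A ∈ 𝓢) (hB : B ∈ 𝓢) (hC : C ∈ 𝓢) (hAB : (A ∩ B).Nonempty)
    (hAC : (A ∩ C).Nonempty) (hBC : (B ∩ C).Nonempty) : (A ∩ B ∩ C).Nonempty := by
  by_cases hAB' : A = B
  · subst hAB'; simpa using hAC
  by_cases hAC' : A = C
  · subst hAC'; rwa [Finset.inter_right_comm, Finset.inter_self]
  by_cases hBC' : B = C
  · subst hBC'; simpa using hAB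
  obtain ⟨x, hx⟩ := hAB
  obtain ⟨y, hy⟩ := hAC
  obtain ⟨z, hz⟩ := hBC
  obtain ⟨F, hF, h⟩ := h {A, B, C} (by grind) ⟨A, by simp⟩
  rcases h with h | ⟨G, hG, hGF, hleaf⟩
  · have h1 : A = F := by rw [← Finset.mem_singleton, ← h]; simp
    have h2 : B = F := by rw [← Finset.mem_singleton, ← h]; simp
    exact absurd (h1.trans h2.symm) hAB'
  · have hl : ∀ H ∈ ({A, B, C} : Finset _), H ≠ F → ∀ v, v ∈ F → v ∈ H → v ∈ G :=
      fun H hH hHF v h1 h2 => hleaf H hH hHF (Finset.mem_inter.2 ⟨h1, h2⟩)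
    have lA := hl A (by simp)
    have lB := hl B (by simp)
    have lC := hl C (by simp)
    simp only [Finset.mem_insert, Finset.mem_singleton] at hF hG
    simp only [Finset.mem_inter] at hx hy hz
    have : x ∈ A ∩ B ∩ C ∨ y ∈ A ∩ B ∩ C ∨ z ∈ A ∩ B ∩ C := by
      simp only [Finset.mem_inter]
      rcases hF with rfl | rfl | rfl <;> rcases hG with rfl | rfl | rfl <;> grind
    rcases this with h | h | h <;> exact ⟨_, h⟩

/-- The Helly property of families with leaves. -/
theorem HasLeaves.exists_mem_of_pairwise_inter :
    ∀ (n : ℕ) {𝓢 : Finset (Finset V)}, 𝓢.card ≤ n → HasLeaves 𝓢 → 𝓢.Nonempty →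
      (∀ A ∈ 𝓢, ∀ B ∈ 𝓢, (A ∩ B).Nonempty) → ∃ y, ∀ A ∈ 𝓢, y ∈ A := by
  intro n
  induction n with
  | zero =>
    intro 𝓢 hc _ hne
    exact absurd (Finset.card_eq_zero.1 (Nat.le_zero.1 hc)) hne.ne_empty
  | succ n ih =>
    rintro 𝓢 hc h ⟨A, hA⟩ hint
    by_cases hne : (𝓢.erase A).Nonempty
    · obtain ⟨y, hy⟩ := ih (𝓢 := (𝓢.erase A).image (A ∩ ·))
        (Finset.card_image_le.trans (by rw [Finset.card_erase_of_mem hA]; omega))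
        ((h.mono (Finset.erase_subset _ _)).image _ (by grind)) (hne.image _) (by
          simp only [Finset.mem_image, forall_exists_index, and_imp]
          rintro _ B hB rfl _ C hC rfl
          have hB := Finset.mem_of_mem_erase hB
          have hC := Finset.mem_of_mem_erase hC
          refine (h.nonempty_inter_inter hA hB hC (hint _ hA _ hB) (hint _ hA _ hC)
            (hint _ hB _ hC)).mono (by grind))
      refine ⟨y, fun B hB => ?_⟩
      obtain ⟨C, hC⟩ := hne
      by_cases hBA : B = A
      · subst hBA
        exact (Finset.mem_inter.1 (hy _ (Finset.mem_image_of_mem _ hC))).1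
      · exact (Finset.mem_inter.1
          (hy _ (Finset.mem_image_of_mem _ (Finset.mem_erase.2 ⟨hBA, hB⟩)))).2
    · obtain ⟨y, hy⟩ := hint A hA A hA
      refine ⟨y, fun B hB => ?_⟩
      by_cases hBA : B = A
      · exact hBA ▸ (Finset.mem_inter.1 hy).1
      · exact absurd ⟨B, Finset.mem_erase.2 ⟨hBA, hB⟩⟩ hne

/-! ### Families with leaves: chordality and simplicial members -/

/-- Two members of `𝓓` that meet. -/
def MeetIn (𝓓 : Finset (Finset V)) (A B : Finset V) : Prop :=
  A ∈ 𝓓 ∧ B ∈ 𝓓 ∧ (A ∩ B).Nonempty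

theorem MeetIn.symm {𝓓 : Finset (Finset V)} {A B : Finset V} (h : MeetIn 𝓓 A B) :
    MeetIn 𝓓 B A :=
  ⟨h.2.1, h.1, by rw [Finset.inter_comm]; exact h.2.2⟩

theorem MeetIn.mono {𝓓 𝓔 : Finset (Finset V)} (hD : 𝓓 ⊆ 𝓔) {A B : Finset V}
    (h : MeetIn 𝓓 A B) : MeetIn 𝓔 A B :=
  ⟨hD h.1, hD h.2.1, h.2.2⟩

theorem reflTransGen_meetIn_symm {𝓓 : Finset (Finset V)} {A B : Finset V}
    (h : Relation.ReflTransGen (MeetIn 𝓓) A B) : Relation.ReflTransGen (MeetIn 𝓓) B A := by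
  induction h with
  | refl => exact .refl
  | tail _ h ih => exact .head h.symm ih

theorem reflTransGen_meetIn_mono {𝓓 𝓔 : Finset (Finset V)} (hD : 𝓓 ⊆ 𝓔) {A B : Finset V}
    (h : Relation.ReflTransGen (MeetIn 𝓓) A B) : Relation.ReflTransGen (MeetIn 𝓔) A B := by
  induction h with
  | refl => exact .refl
  | tail _ h ih => exact .tail ih (h.mono hD)

theorem exists_meetIn_ne {𝓓 : Finset (Finset V)} {A B : Finset V} (hne : A ≠ B)
    (h : Relation.ReflTransGen (MeetIn 𝓓) A B) : ∃ D ∈ 𝓓, D ≠ A ∧ (A ∩ D).Nonempty := by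
  induction h with
  | refl => exact absurd rfl hne
  | @tail D E _ hDE ih =>
    by_cases hD : A = D
    · subst hD
      exact ⟨E, hDE.2.1, hne.symm, hDE.2.2⟩
    · exact ih hD

/-- The intersection graph of a family with leaves is chordal: if `A` and `B` both meet `C` and
are joined by a chain of members of which only `A` and `B` meet `C`, then `A` meets `B`. -/
theorem HasLeaves.nonempty_inter_of_chain {A B C : Finset V} (hAC : (A ∩ C).Nonempty)
    (hBC : (B ∩ C).Nonempty) :
    ∀ (n : ℕ) {𝓓 : Finset (Finset V)}, 𝓓.card ≤ n → HasLeaves (insert C 𝓓) → A ∈ 𝓓 → B ∈ 𝓓 →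
      C ∉ 𝓓 → (∀ D ∈ 𝓓, D ≠ A → D ≠ B → ¬ (D ∩ C).Nonempty) →
      Relation.ReflTransGen (MeetIn 𝓓) A B → (A ∩ B).Nonempty := by
  intro n
  induction n with
  | zero =>
    intro 𝓓 hc _ hA
    exact absurd hA (by simp [Finset.card_eq_zero.1 (Nat.le_zero.1 hc)])
  | succ n ih =>
    intro 𝓓 hc h hA hB hCD hD hconn
    by_contra hAB
    have hne : A ≠ B := by
      rintro rfl
      exact hAB (hAC.mono (by grind))
    -- The branch `G` meets every other member that the leaf `F` meets. If `A` and `B` are disjoint,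
    -- this rules out `F` being `A`, `B` or `C`, so `F` can be dropped and the chain rerouted
    -- through `G`.
    obtain ⟨F, hF, h1⟩ := h _ subset_rfl ⟨C, by simp⟩
    rcases h1 with h1 | ⟨G, hG, hGF, hleaf⟩
    · have h2 : A = F := by rw [← Finset.mem_singleton, ← h1]; simp [hA]
      have h3 : B = F := by rw [← Finset.mem_singleton, ← h1]; simp [hB]
      exact hne (h2.trans h3.symm)
    have meet : ∀ H ∈ insert C 𝓓, H ≠ F → (F ∩ H).Nonempty → (G ∩ H).Nonempty := by
      rintro H hH hHF ⟨v, hv⟩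
      exact ⟨v, Finset.mem_inter.2 ⟨hleaf H hH hHF hv, (Finset.mem_inter.1 hv).2⟩⟩
    have hAm : A ∈ insert C 𝓓 := by simp [hA]
    have hBm : B ∈ insert C 𝓓 := by simp [hB]
    have hCm : C ∈ insert C 𝓓 := by simp
    have hmem : ∀ {H : Finset V}, H ∈ 𝓓 → H ∈ insert C 𝓓 := fun h => Finset.mem_insert_of_mem h
    have branch : ∀ E ∈ 𝓓, E ≠ C → (E ∩ C).Nonempty → E = A ∨ E = B := by
      intro E hE _ hEC
      by_contra hcon
      push Not at hcon
      exact hD E hE hcon.1 hcon.2 hEC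
    have neC : ∀ E ∈ 𝓓, E ≠ C := fun E hE h => hCD (h ▸ hE)
    have hBA : ¬ (B ∩ A).Nonempty := by rwa [Finset.inter_comm]
    have endpoint : ∀ P Q, P ∈ 𝓓 → Q ∈ 𝓓 → P ≠ Q → ¬ (P ∩ Q).Nonempty → (P ∩ C).Nonempty →
        (∀ E ∈ 𝓓, (E ∩ C).Nonempty → E = P ∨ E = Q) →
        Relation.ReflTransGen (MeetIn 𝓓) P Q → F ≠ P := by
      rintro P Q hP hQ hPQ hdisj ⟨v, hv⟩ hends hchain rfl
      have hvG : v ∈ G := hleaf C hCm (neC _ hP).symm hv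
      rw [Finset.mem_inter] at hv
      by_cases hGC : G = C
      · obtain ⟨D, hDm, hDP, w, hw⟩ := exists_meetIn_ne hPQ hchain
        have hwC : w ∈ C := hGC ▸ hleaf D (hmem hDm) hDP hw
        rw [Finset.mem_inter] at hw
        rcases hends D hDm ⟨w, Finset.mem_inter.2 ⟨hw.2, hwC⟩⟩ with h | rfl
        · exact hDP h
        · exact hdisj ⟨w, Finset.mem_inter.2 hw⟩
      · rcases hends G (Finset.mem_of_mem_insert_of_ne hG hGC)
          ⟨v, Finset.mem_inter.2 ⟨hvG, hv.2⟩⟩ with h | rfl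
        · exact hGF h
        · exact hdisj ⟨v, Finset.mem_inter.2 ⟨hv.1, hvG⟩⟩
    have hFA : F ≠ A := endpoint A B hA hB hne hAB hAC
      (fun E hE => branch E hE (neC E hE)) hconn
    have hFB : F ≠ B := endpoint B A hB hA hne.symm hBA hBC
      (fun E hE h => (branch E hE (neC E hE) h).symm)
      (reflTransGen_meetIn_symm hconn)
    have hFC : F ≠ C := by
      rintro rfl
      have hGD : G ∈ 𝓓 := Finset.mem_of_mem_insert_of_ne hG hGF
      have hGA := meet A hAm (neC A hA) (by rwa [Finset.inter_comm])
      have hGB := meet B hBm (neC B hB) (by rwa [Finset.inter_comm])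
      have hGC : (G ∩ F).Nonempty := by
        obtain ⟨v, hv⟩ := hAC
        rw [Finset.mem_inter] at hv
        exact ⟨v, Finset.mem_inter.2
          ⟨hleaf A hAm (neC A hA) (Finset.mem_inter.2 hv.symm), hv.2⟩⟩
      rcases branch G hGD hGF hGC with rfl | rfl
      · exact hAB hGB
      · exact hBA hGA
    have hFD : F ∈ 𝓓 := Finset.mem_of_mem_insert_of_ne hF hFC
    have hGC : ∀ H ∈ 𝓓, H ≠ F → (F ∩ H).Nonempty → G ≠ C := by
      rintro H hH hHF ⟨v, hv⟩ rfl
      exact hD F hFD hFA hFB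
        ⟨v, Finset.mem_inter.2 ⟨(Finset.mem_inter.1 hv).1, hleaf H (hmem hH) hHF hv⟩⟩
    have hA' : A ∈ 𝓓.erase F := Finset.mem_erase.2 ⟨hFA.symm, hA⟩
    have hB' : B ∈ 𝓓.erase F := Finset.mem_erase.2 ⟨hFB.symm, hB⟩
    obtain ⟨G', hG', hG'ne, hG'F⟩ : ∃ G' ∈ 𝓓.erase F, (G' ∩ G').Nonempty ∧
        ∀ H ∈ 𝓓, H ≠ F → (F ∩ H).Nonempty → (G' ∩ H).Nonempty := by
      by_cases h : ∃ H ∈ 𝓓, H ≠ F ∧ (F ∩ H).Nonempty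
      · obtain ⟨H, hH, hHF, hFH⟩ := h
        refine ⟨G, Finset.mem_erase.2 ⟨hGF, Finset.mem_of_mem_insert_of_ne hG
          (hGC H hH hHF hFH)⟩, ?_, fun H hH hHF => meet H (hmem hH) hHF⟩
        rw [Finset.inter_self]
        exact (meet H (hmem hH) hHF hFH).mono Finset.inter_subset_left
      -- Here `F` meets no other member of `𝓓`, so any nonempty substitute serves.
      · refine ⟨A, hA', ?_, fun H hH hHF hFH => absurd ⟨H, hH, hHF, hFH⟩ h⟩
        rw [Finset.inter_self]
        exact hAC.mono Finset.inter_subset_left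
    refine hAB (ih (𝓓 := 𝓓.erase F) (by rw [Finset.card_erase_of_mem hFD]; omega)
      (h.mono (Finset.insert_subset_insert _ (Finset.erase_subset _ _))) hA' hB'
      (fun h => hCD (Finset.mem_of_mem_erase h))
      (fun D hDm => hD D (Finset.mem_of_mem_erase hDm)) ?_)
    have hlift := Relation.ReflTransGen.lift (p := MeetIn (𝓓.erase F))
      (fun E => if E = F then G' else E) ?_ _ _ hconn
    · simpa only [Function.onFun, if_neg hFA.symm, if_neg hFB.symm] using hlift
    · rintro E E' ⟨hE, hE', hEE'⟩
      by_cases h1 : E = F <;> by_cases h2 : E' = F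
      · simp only [Function.onFun, if_pos h1, if_pos h2]
        exact ⟨hG', hG', hG'ne⟩
      · simp only [Function.onFun, if_pos h1, if_neg h2]
        exact ⟨hG', Finset.mem_erase.2 ⟨h2, hE'⟩, hG'F E' hE' h2 (h1 ▸ hEE')⟩
      · simp only [Function.onFun, if_neg h1, if_pos h2]
        refine MeetIn.symm ⟨hG', Finset.mem_erase.2 ⟨h1, hE⟩, hG'F E hE h1 ?_⟩
        rw [Finset.inter_comm]
        exact h2 ▸ hEE'
      · simp only [Function.onFun, if_neg h1, if_neg h2]
        exact ⟨Finset.mem_erase.2 ⟨h1, hE⟩, Finset.mem_erase.2 ⟨h2, hE'⟩, hEE'⟩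

/-- In a family with leaves some member is such that any two members meeting it meet. -/
theorem HasLeaves.exists_simplicial :
    ∀ (n : ℕ) {𝓢 : Finset (Finset V)}, 𝓢.card ≤ n → HasLeaves 𝓢 → (∀ A ∈ 𝓢, A.Nonempty) →
      𝓢.Nonempty → ∃ F ∈ 𝓢, ∀ A ∈ 𝓢, ∀ B ∈ 𝓢, (A ∩ F).Nonempty → (B ∩ F).Nonempty →
        (A ∩ B).Nonempty := by
  classical
  intro n
  induction n with
  | zero =>
    intro 𝓢 hc _ _ hne
    exact absurd (Finset.card_eq_zero.1 (Nat.le_zero.1 hc)) hne.ne_empty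
  | succ n ih =>
    intro 𝓢 hc h hpos hne
    -- Dirac's argument: take a largest connected subfamily missing some member `R`. If there is
    -- none, not even a singleton, then all members meet pairwise.
    let good : Finset (Finset V) → Prop := fun 𝓒 =>
      (∃ A ∈ 𝓒, ∀ B ∈ 𝓒, Relation.ReflTransGen (MeetIn 𝓒) A B) ∧
        ∃ R ∈ 𝓢, ∀ D ∈ 𝓒, ¬ (D ∩ R).Nonempty
    by_cases hex : (𝓢.powerset.filter good).Nonempty
    swap
    · obtain ⟨F, hF⟩ := hne
      refine ⟨F, hF, fun A hA B hB _ _ => ?_⟩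
      by_contra hAB
      refine hex ⟨{A}, Finset.mem_filter.2 ⟨by simpa using hA, ⟨A, by simp, ?_⟩, B, hB, ?_⟩⟩
      · intro D hD
        rw [Finset.mem_singleton.1 hD]
      · intro D hD
        rwa [Finset.mem_singleton.1 hD]
    obtain ⟨𝓒, h𝓒, hmax⟩ := Finset.exists_max_image _ Finset.card hex
    rw [Finset.mem_filter, Finset.mem_powerset] at h𝓒
    obtain ⟨hCS, ⟨A₀, hA₀, hreach⟩, R₀, hR₀, hdisj⟩ := h𝓒
    -- Otherwise `S` could be added to `𝓒`, against maximality.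
    have complete : ∀ S ∈ 𝓢, S ∉ 𝓒 → (∃ D ∈ 𝓒, (D ∩ S).Nonempty) → ∀ R ∈ 𝓢,
        (∀ D ∈ 𝓒, ¬ (D ∩ R).Nonempty) → (S ∩ R).Nonempty := by
      rintro S hS hSC ⟨D, hD, hDS⟩ R hR hRC
      by_contra hSR
      have hle := hmax (insert S 𝓒) (Finset.mem_filter.2
        ⟨Finset.mem_powerset.2 (Finset.insert_subset hS hCS),
          ⟨A₀, Finset.mem_insert_of_mem hA₀, ?_⟩, R, hR, ?_⟩)
      · rw [Finset.card_insert_of_notMem hSC] at hle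
        omega
      · have hm : ∀ E ∈ 𝓒, Relation.ReflTransGen (MeetIn (insert S 𝓒)) A₀ E := fun E hE =>
          reflTransGen_meetIn_mono (Finset.subset_insert _ _) (hreach E hE)
        intro E hE
        rcases Finset.mem_insert.1 hE with rfl | hE
        · exact (hm D hD).tail
            ⟨Finset.mem_insert_of_mem hD, Finset.mem_insert_self _ _, hDS⟩
        · exact hm E hE
      · intro E hE
        rcases Finset.mem_insert.1 hE with rfl | hE
        · exact hSR
        · exact hRC E hE
    -- Both `S` and `T` meet `R₀` and are joined through `𝓒`, whose members miss `R₀`; chordality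
    -- applies.
    have clique : ∀ S ∈ 𝓢, S ∉ 𝓒 → (∃ D ∈ 𝓒, (D ∩ S).Nonempty) → ∀ T ∈ 𝓢, T ∉ 𝓒 →
        (∃ D ∈ 𝓒, (D ∩ T).Nonempty) → (S ∩ T).Nonempty := by
      intro S hS hSC hSm T hT hTC hTm
      have hSR := complete S hS hSC hSm R₀ hR₀ hdisj
      have hTR := complete T hT hTC hTm R₀ hR₀ hdisj
      obtain ⟨D, hD, hDS⟩ := hSm
      obtain ⟨E, hE, hET⟩ := hTm
      by_cases hSR' : S = R₀
      · exact absurd (hSR' ▸ hDS) (hdisj D hD)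
      by_cases hTR' : T = R₀
      · exact absurd (hTR' ▸ hET) (hdisj E hE)
      have hR₀C : R₀ ∉ 𝓒 := fun h => hdisj R₀ h (by simpa using hpos _ hR₀)
      have hsub : 𝓒 ⊆ insert S (insert T 𝓒) :=
        (Finset.subset_insert _ _).trans (Finset.subset_insert _ _)
      have hm : ∀ E ∈ 𝓒, Relation.ReflTransGen (MeetIn (insert S (insert T 𝓒))) A₀ E :=
        fun E hE => reflTransGen_meetIn_mono hsub (hreach E hE)
      refine HasLeaves.nonempty_inter_of_chain hSR hTR _ (𝓓 := insert S (insert T 𝓒)) le_rfl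
        (h.mono (Finset.insert_subset hR₀ (Finset.insert_subset hS (Finset.insert_subset hT hCS))))
        (by simp) (by simp) (by simp [Ne.symm hSR', Ne.symm hTR', hR₀C]) ?_ ?_
      · intro D hD hDS hDT
        exact hdisj D (Finset.mem_of_mem_insert_of_ne (Finset.mem_of_mem_insert_of_ne hD hDS) hDT)
      · refine Relation.ReflTransGen.trans (b := A₀) ?_ ?_
        · exact reflTransGen_meetIn_symm ((hm D hD).tail ⟨hsub hD, by simp, hDS⟩)
        · exact (hm E hE).tail ⟨hsub hE, by simp, hET⟩
    -- A simplicial member of `𝓡` stays simplicial in `𝓢`: its further neighbours all meet `𝓒`,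
    -- hence meet each other and all of `𝓡`.
    let 𝓡 := 𝓢.filter fun R => ∀ D ∈ 𝓒, ¬ (D ∩ R).Nonempty
    have h𝓡 : ∀ {R}, R ∈ 𝓡 ↔ R ∈ 𝓢 ∧ ∀ D ∈ 𝓒, ¬ (D ∩ R).Nonempty := Finset.mem_filter
    have hA₀R : A₀ ∉ 𝓡 := fun h => (h𝓡.1 h).2 A₀ hA₀ (by simpa using hpos _ (hCS hA₀))
    have hcard : 𝓡.card < 𝓢.card := Finset.card_lt_card
      ⟨Finset.filter_subset _ _, fun h => hA₀R (h (hCS hA₀))⟩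
    obtain ⟨F, hF, hsimp⟩ := ih (𝓢 := 𝓡) (by omega) (h.mono (Finset.filter_subset _ _))
      (fun A hA => hpos A (h𝓡.1 hA).1) ⟨R₀, h𝓡.2 ⟨hR₀, hdisj⟩⟩
    obtain ⟨hFS, hFC⟩ := h𝓡.1 hF
    refine ⟨F, hFS, fun A hA B hB hAF hBF => ?_⟩
    have hAC : A ∉ 𝓒 := fun h => hFC A h hAF
    have hBC : B ∉ 𝓒 := fun h => hFC B h hBF
    by_cases hA' : ∃ D ∈ 𝓒, (D ∩ A).Nonempty <;> by_cases hB' : ∃ D ∈ 𝓒, (D ∩ B).Nonempty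
    · exact clique A hA hAC hA' B hB hBC hB'
    · push Not at hB'
      exact complete A hA hAC hA' B hB (by simpa using hB')
    · push Not at hA'
      rw [Finset.inter_comm]
      exact complete B hB hBC hB' A hA (by simpa using hA')
    · push Not at hA' hB'
      exact hsimp A (h𝓡.2 ⟨hA, by simpa using hA'⟩) B (h𝓡.2 ⟨hB, by simpa using hB'⟩) hAF hBF

/-- A family with leaves has a member `F` with a vertex that lies in every member meeting `F`. -/
theorem HasLeaves.exists_dominating {𝓢 : Finset (Finset V)} (h : HasLeaves 𝓢)
    (hpos : ∀ A ∈ 𝓢, A.Nonempty) (hne : 𝓢.Nonempty) :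
    ∃ F ∈ 𝓢, ∃ y ∈ F, ∀ A ∈ 𝓢, (A ∩ F).Nonempty → y ∈ A := by
  obtain ⟨F, hF, hsimp⟩ := HasLeaves.exists_simplicial _ le_rfl h hpos hne
  have hFF : (F ∩ F).Nonempty := by simpa using hpos F hF
  obtain ⟨y, hy⟩ := HasLeaves.exists_mem_of_pairwise_inter _
    (𝓢 := 𝓢.filter fun A => (A ∩ F).Nonempty) le_rfl (h.mono (Finset.filter_subset _ _))
    ⟨F, Finset.mem_filter.2 ⟨hF, hFF⟩⟩ (by
      intro A hA B hB
      rw [Finset.mem_filter] at hA hB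
      exact hsimp A hA.1 B hB.1 hA.2 hB.2)
  exact ⟨F, hF, y, hy F (Finset.mem_filter.2 ⟨hF, hFF⟩),
    fun A hA hAF => hy A (Finset.mem_filter.2 ⟨hA, hAF⟩)⟩

end LeafFamilies

/-! ### Weight complexes and their decomposition -/

section WeightComplex

variable {ι V : Type*}

/-- The complex on the pairs `(v, j)` with `o v ≤ j < N v` whose faces are the sets `W` such that
every choice of a pair `(v, f v)` in `W` for each `v ∈ F i` has total weight `∑ (f v - o v)` at
least `k i`. -/
def weightComplex (F : ι → Finset V) (k : ι → ℕ) (o N : V → ℕ) : Set (Set (V × ℕ)) :=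
  {W | (∀ p ∈ W, o p.1 ≤ p.2 ∧ p.2 < N p.1) ∧
    ∀ i (f : V → ℕ), (∀ v ∈ F i, (v, f v) ∈ W) → k i ≤ ∑ v ∈ F i, (f v - o v)}

variable [DecidableEq V]

theorem sum_sub_update_add_one {A : Finset V} {y : V} (hy : y ∈ A) {f o : V → ℕ}
    (h : o y < f y) :
    ∑ v ∈ A, (f v - Function.update o y (o y + 1) v) + 1 = ∑ v ∈ A, (f v - o v) := by
  rw [← Finset.add_sum_erase _ _ hy, ← Finset.add_sum_erase A (fun v => f v - o v) hy,
    Finset.sum_congr (s₁ := A.erase y) rfl (g := fun v => f v - o v) fun v hv => by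
      rw [Function.update_of_ne (Finset.ne_of_mem_erase hv)]]
  simp only [Function.update_self]
  omega

/-- Without `(y, o y)` every choice has `f y > o y`, so raising the offset costs exactly one unit on
each constraint through `y`. The truncation at `k i = 0` is harmless, both inequalities being
trivial. -/
theorem weightComplex_deletion (F : ι → Finset V) (k : ι → ℕ) (o N : V → ℕ) (y : V) :
    weightComplex F (fun i => if y ∈ F i then k i - 1 else k i)
      (Function.update o y (o y + 1)) N = {W | (y, o y) ∉ W ∧ W ∈ weightComplex F k o N} := by
  have hsum : ∀ (W : Set (V × ℕ)), (y, o y) ∉ W → (∀ p ∈ W, o p.1 ≤ p.2 ∧ p.2 < N p.1) →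
      ∀ (i : ι) (f : V → ℕ), (∀ v ∈ F i, (v, f v) ∈ W) →
      ((if y ∈ F i then k i - 1 else k i) ≤
        ∑ v ∈ F i, (f v - Function.update o y (o y + 1) v) ↔ k i ≤ ∑ v ∈ F i, (f v - o v)) := by
    intro W hyW hb i f hf
    by_cases hy : y ∈ F i
    · have h1 : o y ≤ f y := (hb _ (hf y hy)).1
      have h2 : f y ≠ o y := fun h => hyW (h ▸ hf y hy)
      rw [if_pos hy, ← sum_sub_update_add_one (o := o) hy (by omega)]
      omega
    · rw [if_neg hy, Finset.sum_congr rfl fun v hv => by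
        rw [Function.update_of_ne (ne_of_mem_of_not_mem hv hy)]]
  ext W
  constructor
  · rintro ⟨hb, hW⟩
    have hyW : (y, o y) ∉ W := fun h => by simpa using (hb _ h).1
    have hb' : ∀ p ∈ W, o p.1 ≤ p.2 ∧ p.2 < N p.1 := by
      intro p hp
      refine ⟨le_trans ?_ (hb p hp).1, (hb p hp).2⟩
      by_cases h : p.1 = y
      · rw [h, Function.update_self]
        omega
      · rw [Function.update_of_ne h]
    exact ⟨hyW, hb', fun i f hf => (hsum W hyW hb' i f hf).1 (hW i f hf)⟩
  · rintro ⟨hyW, hb, hW⟩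
    refine ⟨fun p hp => ⟨?_, (hb p hp).2⟩, fun i f hf => (hsum W hyW hb i f hf).2 (hW i f hf)⟩
    have h1 := (hb p hp).1
    by_cases h : p.1 = y
    · rw [h, Function.update_self]
      have h2 : p.2 ≠ o y := fun h' => hyW (by rwa [← h', ← h])
      rw [h] at h1
      omega
    · rwa [Function.update_of_ne h]

/-- With `(y, o y)` present, the cheapest choice at `y` has weight zero, so only the other vertices
of each constraint matter. -/
theorem weightComplex_link (F : ι → Finset V) (k : ι → ℕ) {o N : V → ℕ} {y : V}
    (hy : o y < N y) :
    weightComplex (fun i => (F i).erase y) k (Function.update o y (o y + 1)) N =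
      {W | (y, o y) ∉ W ∧ insert (y, o y) W ∈ weightComplex F k o N} := by
  have hsum : ∀ (A : Finset V) (f : V → ℕ),
      ∑ v ∈ A.erase y, (f v - Function.update o y (o y + 1) v) =
        ∑ v ∈ A.erase y, (f v - o v) := fun A f =>
    Finset.sum_congr rfl fun v hv => by
      rw [Function.update_of_ne (Finset.ne_of_mem_erase hv)]
  ext W
  constructor
  · rintro ⟨hb, hW⟩
    have hyW : (y, o y) ∉ W := fun h => by simpa using (hb _ h).1
    refine ⟨hyW, ?_, fun i f hf => ?_⟩
    · rintro p (rfl | hp)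
      · exact ⟨le_rfl, hy⟩
      · refine ⟨le_trans ?_ (hb p hp).1, (hb p hp).2⟩
        by_cases h : p.1 = y
        · rw [h, Function.update_self]
          omega
        · rw [Function.update_of_ne h]
    · refine (hW i f fun v hv => ?_).trans ?_
      · exact (hf v (Finset.mem_of_mem_erase hv)).resolve_left fun h =>
          Finset.ne_of_mem_erase hv (Prod.ext_iff.1 h).1
      · rw [hsum]
        exact Finset.sum_le_sum_of_subset (Finset.erase_subset _ _)
  · rintro ⟨hyW, hb, hW⟩
    refine ⟨fun p hp => ⟨?_, (hb p (Or.inr hp)).2⟩, fun i f hf => ?_⟩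
    · have h1 := (hb p (Or.inr hp)).1
      by_cases h : p.1 = y
      · rw [h, Function.update_self]
        have h2 : p.2 ≠ o y := fun h' => hyW (by rwa [← h', ← h])
        rw [h] at h1
        omega
      · rwa [Function.update_of_ne h]
    · refine (hW i (Function.update f y (o y)) fun v hv => ?_).trans_eq ?_
      · by_cases h : v = y
        · subst h
          simp
        · rw [Function.update_of_ne h]
          exact Or.inr (hf v (Finset.mem_erase.2 ⟨h, hv⟩))
      · rw [hsum, ← Finset.sum_erase (F i) (a := y) (by simp)]
        exact Finset.sum_congr rfl fun v hv => by
          rw [Function.update_of_ne (Finset.ne_of_mem_erase hv)]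

/-- If every constraint of positive weight meeting `F i₀` contains `y ∈ F i₀`, then the vertex
`(y, o y)` is a shedding vertex. -/
theorem weightComplex_shedding {F : ι → Finset V} {k : ι → ℕ} {o N : V → ℕ} {i₀ : ι} {y : V}
    (hcap : ∀ i, 0 < k i → ∀ v ∈ F i, o v + k i ≤ N v) (hi₀ : 0 < k i₀)
    (hdom : ∀ i, 0 < k i → (F i ∩ F i₀).Nonempty → y ∈ F i) {W : Set (V × ℕ)}
    (hyW : (y, o y) ∉ W) (hW : insert (y, o y) W ∈ weightComplex F k o N) :
    ∃ W' ∈ weightComplex F k o N, (y, o y) ∉ W' ∧ W ⊂ W' := by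
  obtain ⟨hb, hW⟩ := hW
  -- Otherwise the choice `o` lies in the face and has weight zero, less than `k i₀`.
  obtain ⟨z, hz, hzy, hzW⟩ : ∃ z ∈ F i₀, z ≠ y ∧ (z, o z) ∉ W := by
    by_contra! hcon
    have := hW i₀ o fun v hv => by
      by_cases h : v = y
      · exact Or.inl (h ▸ rfl)
      · exact Or.inr (hcon v hv h)
    simp only [Nat.sub_self, Finset.sum_const_zero] at this
    omega
  have hzN := hcap i₀ hi₀ z hz
  -- Climb the column of `z` from the missing pair `(z, o z)` to a gap just below a pair of `W` or
  -- at the top; `(z, j)` is the pair to add.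
  obtain ⟨j, hj₁, hj₂, hjW, hj⟩ : ∃ j, o z ≤ j ∧ j < N z ∧ (z, j) ∉ W ∧
      (j + 1 = N z ∨ (z, j + 1) ∈ W) := by
    by_contra! hcon
    have key : ∀ d, o z + d < N z → (z, o z + d) ∉ W := by
      intro d
      induction d with
      | zero => exact fun _ => hzW
      | succ d ih =>
        intro hd
        exact (hcon (o z + d) (by omega) (by omega) (ih (by omega))).2
    have h1 : o z + (N z - o z - 1) = N z - 1 := by omega
    have h2 := key (N z - o z - 1) (by omega)
    rw [h1] at h2
    exact (hcon (N z - 1) (by omega) (by omega) h2).1 (by omega)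
  refine ⟨insert (z, j) W, ⟨?_, fun i f hf => ?_⟩, ?_, Set.ssubset_insert hjW⟩
  · rintro p (rfl | hp)
    · exact ⟨hj₁, hj₂⟩
    · exact hb p (Or.inr hp)
  · rcases Nat.eq_zero_or_pos (k i) with hk | hk
    · omega
    by_cases hfW : ∀ v ∈ F i, (v, f v) ∈ W
    · exact hW i f fun v hv => Or.inr (hfW v hv)
    push Not at hfW
    obtain ⟨v, hv, hvW⟩ := hfW
    have hvz := Prod.ext_iff.1 ((hf v hv).resolve_right hvW)
    obtain rfl : v = z := hvz.1
    obtain rfl : f v = j := hvz.2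
    have hfW : ∀ w ∈ F i, w ≠ v → (w, f w) ∈ W := fun w hw hwv =>
      (hf w hw).resolve_left fun h => hwv (Prod.ext_iff.1 h).1
    have hy : y ∈ F i := hdom i hk ⟨v, Finset.mem_inter.2 ⟨hv, hz⟩⟩
    have hyf : (y, f y) ∈ W := hfW y hy hzy.symm
    have hy₁ : o y ≤ f y := (hb _ (Or.inr hyf)).1
    have hy₂ : f y ≠ o y := fun h => hyW (h ▸ hyf)
    have hsplit : ∀ g : V → ℕ, ∑ w ∈ F i, g w = g v + (g y + ∑ w ∈ ((F i).erase v).erase y, g w) :=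
      fun g => by
        rw [← Finset.add_sum_erase _ _ hv,
          ← Finset.add_sum_erase _ _ (Finset.mem_erase.2 ⟨hzy.symm, hy⟩)]
    rw [hsplit]
    rcases hj with hj | hj
    -- At the top, `z` contributes at least `k i - 1` by capacity, and `y` at least 1.
    · have := hcap i hk v hv
      omega
    -- Raising `z` by one and lowering `y` to `o y` gives a choice inside the given face; it weighs
    -- no more than `f`, because `f y > o y`.
    · have := hW i (Function.update (Function.update f v (f v + 1)) y (o y)) fun w hw => by
        by_cases hwy : w = y
        · subst hwy
          simp
        · rw [Function.update_of_ne hwy]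
          by_cases hwv : w = v
          · subst hwv
            rw [Function.update_self]
            exact Or.inr hj
          · rw [Function.update_of_ne hwv]
            exact Or.inr (hfW w hw hwv)
      rw [hsplit, Finset.sum_congr (s₁ := ((F i).erase v).erase y) rfl
        (g := fun w => f w - o w) fun w hw => by
          rw [Function.update_of_ne (Finset.ne_of_mem_erase hw),
            Function.update_of_ne (Finset.ne_of_mem_erase (Finset.mem_of_mem_erase hw))],
        Function.update_self, Function.update_of_ne hzy, Function.update_self] at this
      omega
  · rintro (h | h)
    · exact hzy (Prod.ext_iff.1 h).1.symm
    · exact hyW h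

theorem weightComplex_isVertexDecomposable [Fintype ι] [Fintype V] (n : ℕ) :
    ∀ (F : ι → Finset V) (k : ι → ℕ) (o N : V → ℕ), ∑ v, (N v - o v) < n →
      HasLeaves (Finset.univ.image F) → (∀ i, 0 < k i → (F i).Nonempty) →
      (∀ i, 0 < k i → ∀ v ∈ F i, o v + k i ≤ N v) →
      IsVertexDecomposableComplex (weightComplex F k o N) := by
  induction n with
  | zero => exact fun _ _ _ _ h => absurd h (Nat.not_lt_zero _)
  | succ n ih =>
    intro F k o N hn hF hpos hcap
    by_cases hactive : ∃ i, 0 < k i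
    swap
    · push Not at hactive
      have : weightComplex F k o N = 𝒫 {p | o p.1 ≤ p.2 ∧ p.2 < N p.1} := by
        ext W
        exact ⟨fun h => h.1, fun h => ⟨h, fun i f _ => (hactive i).trans (Nat.zero_le _)⟩⟩
      rw [this]
      exact .simplex _
    obtain ⟨A, hA, y, hyA, hdom⟩ := HasLeaves.exists_dominating
      (𝓢 := (Finset.univ.filter fun i => 0 < k i).image F)
      (hF.mono (Finset.image_subset_image (Finset.filter_subset _ _)))
      (by simpa using hpos) (by
        obtain ⟨i, hi⟩ := hactive
        exact ⟨F i, Finset.mem_image_of_mem _ (by simpa using hi)⟩)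
    obtain ⟨i₀, hi₀, rfl⟩ := Finset.mem_image.1 hA
    replace hi₀ : 0 < k i₀ := (Finset.mem_filter.1 hi₀).2
    replace hdom : ∀ i, 0 < k i → (F i ∩ F i₀).Nonempty → y ∈ F i := fun i hi =>
      hdom _ (Finset.mem_image_of_mem _ (by simpa using hi))
    have hyN : o y < N y := by
      have := hcap i₀ hi₀ y hyA
      omega
    have hn' : ∑ v, (N v - Function.update o y (o y + 1) v) < n := by
      refine (Finset.sum_lt_sum (fun v _ => ?_) ⟨y, Finset.mem_univ y, ?_⟩).trans_le
        (Nat.lt_succ_iff.1 hn)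
      · by_cases h : v = y
        · rw [h, Function.update_self]
          omega
        · rw [Function.update_of_ne h]
      · rw [Function.update_self]
        omega
    have hdel : IsVertexDecomposableComplex (weightComplex F
        (fun i => if y ∈ F i then k i - 1 else k i) (Function.update o y (o y + 1)) N) := by
      have hk : ∀ i, (if y ∈ F i then k i - 1 else k i) ≤ k i := fun i => by
        split_ifs <;> omega
      refine ih _ _ _ _ hn' hF (fun i hi => hpos i (hi.trans_le (hk i))) fun i hi v hv => ?_
      have h1 := hcap i (hi.trans_le (hk i)) v hv
      by_cases h : v = y
      · subst h
        simp only [if_pos hv, Function.update_self] at hi ⊢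
        omega
      · rw [Function.update_of_ne h]
        exact (Nat.add_le_add_left (hk i) _).trans h1
    -- If an active constraint is `{y}`, then `(y, o y)` lies in no face and the complex equals its
    -- deletion.
    by_cases hloop : ∃ i, 0 < k i ∧ F i = {y}
    · obtain ⟨i, hi, hFi⟩ := hloop
      rw [weightComplex_deletion] at hdel
      convert hdel using 1
      ext W
      refine ⟨fun hW => ⟨fun hyW => ?_, hW⟩, fun hW => hW.2⟩
      have := hW.2 i o (by simpa [hFi] using hyW)
      simp only [Nat.sub_self, Finset.sum_const_zero] at this
      omega
    · push Not at hloop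
      refine .shedding _ (y, o y) ⟨?_, fun i f hf => ?_⟩ ?_ ?_ ?_
      · rintro _ rfl
        exact ⟨le_rfl, hyN⟩
      · rcases Nat.eq_zero_or_pos (k i) with hk | hk
        · omega
        · refine absurd (Finset.eq_singleton_iff_nonempty_unique_mem.2
            ⟨hpos i hk, fun v hv => ?_⟩) (hloop i hk)
          exact (Prod.ext_iff.1 (hf v hv)).1
      · rw [← weightComplex_link F k hyN]
        refine ih _ _ _ _ hn' ?_ (fun i hi => ?_) fun i hi v hv => ?_
        · have := hF.image (fun A => A.erase y) (by grind)
          rwa [Finset.image_image] at this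
        · by_contra hcon
          rw [Finset.not_nonempty_iff_eq_empty, Finset.erase_eq_empty_iff] at hcon
          exact hcon.elim (hpos i hi).ne_empty (hloop i hi)
        · rw [Function.update_of_ne (Finset.ne_of_mem_erase hv)]
          exact hcap i hi v (Finset.mem_of_mem_erase hv)
      · rwa [← weightComplex_deletion]
      · exact fun W hyW hW => weightComplex_shedding hcap hi₀ hdom hyW hW

end WeightComplex

/-! ### Facets of simplicial trees -/

namespace PreAbstractSimplicialComplex

variable {V : Type*}

theorem nonempty_of_mem_facets {Δ : PreAbstractSimplicialComplex V} {A : Finset V}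
    (hA : A ∈ Δ.facets) : A.Nonempty :=
  (Δ.isRelLowerSet_faces hA.prop).1

theorem eq_of_subset_of_mem_facets {Δ : PreAbstractSimplicialComplex V} {A B : Finset V}
    (hA : A ∈ Δ.facets) (hB : B ∈ Δ.facets) (h : A ⊆ B) : A = B :=
  hA.eq_of_le hB.prop h

/-- The complex whose faces are the non-empty subsets of members of `𝓣`. -/
def generatedBy (𝓣 : Finset (Finset V)) : PreAbstractSimplicialComplex V where
  faces := {s | s.Nonempty ∧ ∃ A ∈ 𝓣, s ⊆ A}
  isRelLowerSet_faces := fun _ hs =>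
    ⟨hs.1, fun _ hts ht => ⟨ht, hs.2.imp fun _ hA => ⟨hA.1, hts.trans hA.2⟩⟩⟩

/-- Facets are pairwise incomparable, so any finite set of them is the exact facet set of a
subcollection; this turns leaves of subcollections into `HasLeaves`. -/
theorem facets_generatedBy {Δ : PreAbstractSimplicialComplex V} {𝓣 : Finset (Finset V)}
    (h : ∀ A ∈ 𝓣, A ∈ Δ.facets) : (generatedBy 𝓣).facets = 𝓣 := by
  ext F
  constructor
  · intro hF
    obtain ⟨A, hA, hFA⟩ := hF.prop.2
    rwa [hF.eq_of_le ⟨nonempty_of_mem_facets (h A hA), A, hA, subset_rfl⟩ hFA]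
  · intro hF
    refine ⟨⟨nonempty_of_mem_facets (h F hF), F, hF, subset_rfl⟩, ?_⟩
    rintro G ⟨-, A, hA, hGA⟩ hFG
    rwa [eq_of_subset_of_mem_facets (h F hF) (h A hA) (hFG.trans hGA)]

theorem IsSimplicialTree.hasLeaves [DecidableEq V] {Δ : PreAbstractSimplicialComplex V}
    (hΔ : Δ.IsSimplicialTree) {𝓢 : Finset (Finset V)} (h𝓢 : ∀ A ∈ 𝓢, A ∈ Δ.facets) :
    HasLeaves 𝓢 := by
  intro 𝓣 hT hne
  have hfac := facets_generatedBy fun A hA => h𝓢 A (hT hA)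
  obtain ⟨F, hF, h⟩ := hΔ.2 (generatedBy 𝓣)
    (by rw [IsSubcollection, hfac]; exact fun A hA => h𝓢 A (hT hA))
    (by rw [hfac]; exact hne)
  rw [hfac] at hF h
  refine ⟨F, hF, h.imp (fun h => by exact_mod_cast h) ?_⟩
  rintro ⟨G, hG, hGF, hleaf⟩
  refine ⟨G, hG, hGF, fun H hH hHF v hv => ?_⟩
  rw [Finset.mem_inter] at hv
  exact (hleaf H hH hHF hv).2

/-- Edges are graphs of functions on facets; inclusion of graphs forces inclusion, hence equality,
of the facets and agreement of the functions. -/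
theorem isSimple_expansion_facetHypergraph (Δ : PreAbstractSimplicialComplex V)
    (k : Δ.facetHypergraph.edgeSet → ℕ) : (Δ.facetHypergraph.expansion k).IsSimple := by
  constructor
  · rintro ⟨⟨_, A, hA, rfl⟩, f, -, -, h⟩
    obtain ⟨v, hv⟩ := nonempty_of_mem_facets hA
    exact Set.notMem_empty _ (h ▸ Set.mem_image_of_mem _ hv)
  · rintro _ ⟨⟨_, A, hA, rfl⟩, f, -, -, rfl⟩ _ ⟨⟨_, B, hB, rfl⟩, g, -, -, rfl⟩ h
    have key : ∀ v ∈ A, v ∈ B ∧ f v = g v := by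
      intro v hv
      obtain ⟨w, hw, hwv⟩ := h (Set.mem_image_of_mem _ hv)
      obtain ⟨rfl, hfg⟩ := Prod.ext_iff.1 hwv
      exact ⟨hw, hfg.symm⟩
    obtain rfl := eq_of_subset_of_mem_facets hA hB fun v hv => (key v hv).1
    exact Set.image_congr fun v hv => by rw [(key v hv).2]

end PreAbstractSimplicialComplex

/-! ### The independence complex of an expansion -/

namespace Hypergraph

/-- The independence complex of an expansion is a weight complex. -/
theorem setOf_isIndependent_expansion {V : Type*} [Finite V] (H : Hypergraph V)
    [Fintype H.edgeSet] [DecidableEq V] (k : H.edgeSet → ℕ)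
    (hk : ∀ F, 0 < k F) (F : H.edgeSet → Finset V) (hF : ∀ i, (F i : Set V) = i) :
    {W | (H.expansion k).IsIndependent W} = weightComplex F k (fun _ => 1)
      (fun v => (Finset.univ.filter fun i => v ∈ F i).sup k + 1) := by
  have hvert : ∀ p : V × ℕ, p ∈ (H.expansion k).vertexSet ↔
      1 ≤ p.2 ∧ p.2 < (Finset.univ.filter fun i => p.1 ∈ F i).sup k + 1 := by
    rintro ⟨v, j⟩
    rw [Nat.lt_succ_iff]
    constructor
    · rintro ⟨i, hv, h1, h2⟩
      rw [max_eq_right (hk i)] at h2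
      exact ⟨h1, h2.trans (Finset.le_sup (Finset.mem_filter.2
        ⟨Finset.mem_univ i, by rwa [← Finset.mem_coe, hF]⟩))⟩
    · rintro ⟨h1, h2⟩
      obtain ⟨i, hi, hji⟩ := (Finset.le_sup_iff (Nat.lt_of_lt_of_le Nat.zero_lt_one h1)).1 h2
      refine ⟨i, ?_, h1, hji.trans (le_max_right _ _)⟩
      rw [← hF]
      exact (Finset.mem_filter.1 hi).2
  have hsum : ∀ (i : H.edgeSet) (f : V → ℕ), (∀ v ∈ F i, 1 ≤ f v) →
      (∑ᶠ v ∈ (i : Set V), f v ≤ k i + (i : Set V).ncard - 1 ↔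
        ∑ v ∈ F i, (f v - 1) < k i) := by
    intro i f hf
    have h1 : ∑ v ∈ F i, f v = ∑ v ∈ F i, (f v - 1) + (F i).card := by
      rw [Finset.card_eq_sum_ones, ← Finset.sum_add_distrib]
      exact Finset.sum_congr rfl fun v hv => (Nat.sub_add_cancel (hf v hv)).symm
    rw [← hF i, finsum_mem_coe_finset, Set.ncard_coe_finset, h1]
    have := hk i
    omega
  ext W
  rw [Set.mem_ofPred_eq, isIndependent_iff]
  rw [Set.subset_def, forall₂_congr fun p _ => hvert p]
  refine and_congr_right fun hb => ⟨fun h i f hf => ?_, ?_⟩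
  · by_contra! hlt
    have h1 : ∀ v ∈ F i, 1 ≤ f v := fun v hv => (hb _ (hf v hv)).1
    have h2 : ∀ v ∈ (i : Set V), v ∈ F i := fun v hv => by rwa [← Finset.mem_coe, hF]
    refine h _ ⟨i, f, fun v hv => ⟨h1 v (h2 v hv), ?_⟩, (hsum i f h1).2 hlt, rfl⟩ ?_
    -- The bound `f v ≤ k i` follows from the total: `f v - 1` is at most the sum, which is below `k
    -- i`.
    · have := Finset.single_le_sum (f := fun v => f v - 1) (fun _ _ => Nat.zero_le _) (h2 v hv)
      omega
    · rintro _ ⟨v, hv, rfl⟩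
      exact hf v (h2 v hv)
  · rintro h _ ⟨i, f, hf, hs, rfl⟩ hW
    have h1 : ∀ v ∈ F i, v ∈ (i : Set V) := fun v hv => by rwa [← hF, Finset.mem_coe]
    rw [hsum i f fun v hv => (hf v (h1 v hv)).1] at hs
    exact absurd (h i f fun v hv => hW (Set.mem_image_of_mem _ (h1 v hv))) (Nat.not_le.2 hs)

end Hypergraph

theorem theorem3p4 {V : Type*} [Finite V] (Δ : PreAbstractSimplicialComplex V)
    (hΔ : Δ.IsSimplicialTree) (k : Δ.facetHypergraph.edgeSet → ℕ) (hk : ∀ F, 0 < k F) :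
    (Δ.facetHypergraph.expansion k).IsVertexDecomposable := by
  classical
  have := Fintype.ofFinite V
  have := Fintype.ofFinite Δ.facetHypergraph.edgeSet
  have hfacet : ∀ i : Δ.facetHypergraph.edgeSet, ∃ A ∈ Δ.facets, (A : Set V) = i := fun i => i.2
  choose F hF hFi using hfacet
  refine (Δ.isSimple_expansion_facetHypergraph k).isVertexDecomposable ?_
    (Δ.facetHypergraph.setOf_isIndependent_expansion k hk F hFi)
  refine weightComplex_isVertexDecomposable _ _ _ _ _ (Nat.lt_succ_self _) (hΔ.hasLeaves ?_)
    (fun i _ => PreAbstractSimplicialComplex.nonempty_of_mem_facets (hF i)) fun i _ v hv => ?_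
  · intro A hA
    obtain ⟨i, -, rfl⟩ := Finset.mem_image.1 hA
    exact hF i
  · have : k i ≤ (Finset.univ.filter fun i => v ∈ F i).sup k :=
      Finset.le_sup (Finset.mem_filter.2 ⟨Finset.mem_univ i, hv⟩)
    omega
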